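/- A numerical semigroup is a submonoid $S$ of $(\mathbb{N},+)$, where $\mathbb{N}=\{0,1,2,\dots\}$, with finite complement; its genus $g(S)$ is the number $\#(\mathbb{N}\setminus S)$ of its gaps, its multiplicity $m(S)$ is its smallest positive element and, if $S\ne\mathbb{N}$, its Frobenius number $F(S)$ is its largest gap. The ordinary numerical semigroup of genus $g$ is $S_g=\{0,g+1,g+2,\dots\}$. If $S\neq S_g$ is a numerical semigroup of genus $g$, its ordinarization transform $(S\cup\{F(S)\})\setminus\{m(S)\}$ is again a numerical semigroup of genus $g$, and iterating the transform one reaches $S_g$ after finitely many steps; the number of steps needed is the ordinarization number $r(S)$ (so $r(S_g)=0$). Let $n_{g,r}$ be the number of numerical semigroups of genus $g$ with ordinarization number $r$. **Theorem 3.1.** Let $r\ge 1$ be a fixed integer. Then $n_{g,r}$, as a function of $g$, is eventually quasipolynomial of degree exactly $2r$. That is, there are periodic functions $c_0,c_1,\dots,c_{2r}\colon\mathbb{N}\to\mathbb{Q}$, with $c_{2r}$ not the zero function, such that for all sufficiently large $g$ $$n_{g,r}=c_{2r}(g)\,g^{2r}+\cdots+c_1(g)\,g+c_0(g).$$ -/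

import Mathlib

/-- A numerical semigroup: a submonoid of `(ℕ, +)` with finite complement. -/
structure NumericalSemigroup extends AddSubmonoid ℕ where
  finite_gaps : {n : ℕ | n ∉ carrier}.Finite

namespace NumericalSemigroup

/-- The genus `g(S)`: the number of gaps, i.e. of natural numbers not in `S`. -/
noncomputable def genus (S : NumericalSemigroup) : ℕ :=
  {n : ℕ | n ∉ S.carrier}.ncard

/-- The largest gap `F` of a set of natural numbers (its Frobenius number), for sets whose
complement is finite and nonempty. -/
noncomputable def frobeniusOf (A : Set ℕ) : ℕ := sSup {n : ℕ | n ∉ A}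

/-- The multiplicity `m` of a set of natural numbers: its smallest positive element. -/
noncomputable def multiplicityOf (A : Set ℕ) : ℕ := sInf {n : ℕ | n ∈ A ∧ 0 < n}

/-- The underlying set `{0, g + 1, g + 2, …}` of the ordinary numerical semigroup of genus `g`. -/
def ordinary (g : ℕ) : Set ℕ := {n : ℕ | n = 0 ∨ g + 1 ≤ n}

/-- The ordinarization transform `A ↦ (A ∪ {F(A)}) \ {m(A)}`. Applied to a numerical semigroup of
genus `g` other than the ordinary one, it gives a numerical semigroup of genus `g`. -/
noncomputable def ordinarizationTransform (A : Set ℕ) : Set ℕ :=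
  (A ∪ {frobeniusOf A}) \ {multiplicityOf A}

/-- The ordinarization number `r(S)`: the number of ordinarization transforms that lead from `S` to
the ordinary semigroup of the same genus (the length of the path from `S` to the root of the
ordinarization tree). It is the first time at which the sequence of iterated transforms of `S`
meets the ordinary semigroup, so that only non-ordinary semigroups are ever transformed. -/
noncomputable def ordinarizationNumber (S : NumericalSemigroup) : ℕ :=
  sInf {k : ℕ | ordinarizationTransform^[k] S.carrier = ordinary S.genus}

/-- `n_{g,r}`: the number of numerical semigroups of genus `g` with ordinarization number `r`. -/
noncomputable def count (g r : ℕ) : ℕ :=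
  {S : NumericalSemigroup | S.genus = g ∧ S.ordinarizationNumber = r}.ncard

end NumericalSemigroup

/-- `Q` is a quasipolynomial of degree exactly `n`:
`Q(t) = c_n(t) t^n + ⋯ + c_1(t) t + c_0(t)` with periodic coefficients `c_0, …, c_n`, where `c_n` is
not the zero function. -/
def IsQuasipolynomialOfDegree (Q : ℕ → ℚ) (n : ℕ) : Prop :=
  ∃ c : Fin (n + 1) → ℕ → ℚ,
    (∀ i, ∃ p : ℕ, 0 < p ∧ Function.Periodic (c i) p) ∧
    c (Fin.last n) ≠ 0 ∧
    ∀ t : ℕ, Q t = ∑ i : Fin (n + 1), c i t * (t : ℚ) ^ (i : ℕ)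

/-- `f` agrees with a quasipolynomial of degree exactly `n` at all sufficiently large arguments. -/
def IsEventuallyQuasipolynomialOfDegree (f : ℕ → ℕ) (n : ℕ) : Prop :=
  ∃ Q : ℕ → ℚ, IsQuasipolynomialOfDegree Q n ∧ ∀ᶠ t in Filter.atTop, (f t : ℚ) = Q t

/-! Each ordinarization step trades the least positive element, which is at most `g`, for the
largest gap, which exceeds `g`. Hence `r(S)` is the number of positive elements of `S` up to `g`,
and this is also the number of gaps beyond `g` (`ordinarizationNumber_eq`,
`HasSmallElements.ncard_large`). So `S` is encoded by `g`, its `r` small elements `a` and its `r`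
large gaps `b`; closure under addition becomes a Boolean combination of linear inequalities in `(g,
a, b)` (`count_eq`, `IsGapDatum.splitsSemilinear`).

Such a set is a finite disjoint union of injective affine images of free monoids `ℕ^κ`, by Elliott's
elimination for one linear equation plus slack variables (`setOf_eq_pi`, `inter_setOf_le`). On each
piece, counting points with a given `g` counts solutions of one equation with positive coefficients,
which is eventually quasipolynomial because it is built up by difference equations
(`eventuallyQuasipolynomial_ncard`).

The degree comes from growth alone: the count is at most `(2g+1)^(2r)`, and at `g = 3rk` it is at
least `k^(2r)` (`count_le`, `pow_le_count`). -/

/-! ### Unambiguous semilinear sets -/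

/-- A finite disjoint union of ranges of injective affine maps from free commutative monoids
`κ → ℕ` of finite rank. -/
inductive UnambiguousSemilinear {M : Type*} [AddCommMonoid M] : Set M → Prop
  | empty : UnambiguousSemilinear ∅
  | free {κ : Type} [Finite κ] (b : M) (φ : (κ → ℕ) →+ M)
      (h : Function.Injective fun y => b + φ y) :
      UnambiguousSemilinear (Set.range fun y => b + φ y)
  | union {s t : Set M} : UnambiguousSemilinear s → UnambiguousSemilinear t → Disjoint s t →
      UnambiguousSemilinear (s ∪ t)

namespace UnambiguousSemilinear

variable {M M' : Type*} [AddCommMonoid M] [AddCommMonoid M']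

theorem image {T : Set M} (hT : UnambiguousSemilinear T) (b : M') (φ : M →+ M')
    (h : Set.InjOn (fun x => b + φ x) T) :
    UnambiguousSemilinear ((fun x => b + φ x) '' T) := by
  induction hT with
  | empty => simpa using empty
  | @free κ _ b₀ φ₀ h₀ =>
    have hinj : Function.Injective fun y => (b + φ b₀) + (φ.comp φ₀) y := by
      intro y z hyz
      refine h₀ (h ⟨y, rfl⟩ ⟨z, rfl⟩ ?_)
      simpa [add_assoc] using hyz
    convert free (b + φ b₀) (φ.comp φ₀) hinj using 1
    rw [← Set.range_comp]
    congr 1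
    ext y
    simp [add_assoc]
  | union hs ht hd ihs iht =>
    rw [Set.image_union]
    refine union (ihs (h.mono Set.subset_union_left)) (iht (h.mono Set.subset_union_right)) ?_
    rw [Set.disjoint_left]
    rintro _ ⟨x, hx, rfl⟩ ⟨y, hy, hxy⟩
    have := h (Or.inr hy) (Or.inl hx) hxy
    exact Set.disjoint_left.1 hd hx (this ▸ hy)

/-- Fibres over distinct points are disjoint, so finitely many of them may be treated separately. -/
theorem of_fibers {β : Type*} {T : Set M} (π : M → β) (F : Finset β) (hF : ∀ x ∈ T, π x ∈ F)
    (h : ∀ y ∈ F, UnambiguousSemilinear {x | x ∈ T ∧ π x = y}) : UnambiguousSemilinear T := by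
  classical
  suffices H : ∀ G ⊆ F, UnambiguousSemilinear {x | x ∈ T ∧ π x ∈ G} by
    convert H F subset_rfl using 1
    ext x
    exact ⟨fun hx => ⟨hx, hF x hx⟩, fun hx => hx.1⟩
  intro G
  induction G using Finset.induction_on with
  | empty => intro _; simpa using empty
  | insert y G hy ih =>
    intro hG
    have h1 := h y (hG (Finset.mem_insert_self _ _))
    have h2 := ih ((Finset.subset_insert _ _).trans hG)
    convert union h1 h2 ?_ using 1
    · ext x
      simp only [Finset.mem_insert, Set.mem_ofPred_eq, Set.mem_union]
      tauto
    · rw [Set.disjoint_left]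
      rintro x ⟨_, rfl⟩ ⟨_, hx⟩
      exact hy hx

theorem range_of_injective {κ : Type} [Finite κ] (φ : (κ → ℕ) →+ M)
    (h : Function.Injective φ) : UnambiguousSemilinear (Set.range φ) := by
  simpa using free 0 φ (by simpa using h)

end UnambiguousSemilinear

/-! ### Solutions of one linear equation or inequality over `ℕ` -/

section LinearEquation

variable {κ : Type} [DecidableEq κ]

/-- The transvection `x ↦ x + x j • e i`. -/
def transvectionHom (i j : κ) : (κ → ℕ) →+ (κ → ℕ) where
  toFun x := x + Pi.single i (x j)
  map_zero' := by simp
  map_add' x y := by rw [Pi.add_apply, Pi.single_add]; abel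

theorem transvectionHom_apply (i j : κ) (x : κ → ℕ) :
    transvectionHom i j x = x + Pi.single i (x j) := rfl

theorem transvectionHom_injective {i j : κ} (hij : i ≠ j) :
    Function.Injective (transvectionHom i j) := by
  intro x y h
  have hj : x j = y j := by
    have := congrFun h j
    simpa [transvectionHom_apply, hij.symm] using this
  simpa [transvectionHom_apply, hj] using h

theorem range_transvectionHom {i j : κ} (hij : i ≠ j) :
    Set.range (transvectionHom i j) = {x | x j ≤ x i} := by
  ext x
  constructor
  · rintro ⟨y, rfl⟩
    simp [transvectionHom_apply, hij.symm]
  · intro hx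
    refine ⟨Function.update x i (x i - x j), ?_⟩
    ext k
    simp only [Set.mem_ofPred_eq] at hx
    by_cases hk : k = i
    · subst hk
      simp [transvectionHom_apply, hij.symm, hx]
    · simp [transvectionHom_apply, hij.symm, hk]

theorem map_transvectionHom_single {N : Type*} [AddCommMonoid N] (ℓ : (κ → ℕ) →+ N) {i j : κ}
    (k : κ) : ℓ (transvectionHom i j (Pi.single k 1)) =
      if k = j then ℓ (Pi.single i 1) + ℓ (Pi.single j 1) else ℓ (Pi.single k 1) := by
  rw [transvectionHom_apply]
  split_ifs with h
  · subst h
    simp [add_comm]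
  · simp [Pi.single_eq_of_ne' h]

/-- Elliott's reduction: it suffices to treat the equations obtained by splitting according to
whether `x j ≤ x i` or `x i < x j`. -/
theorem UnambiguousSemilinear.setOf_eq_of_transvection (ℓ : (κ → ℕ) →+ ℤ) {i j : κ} (hij : i ≠ j)
    (h₁ : ∀ c, UnambiguousSemilinear {x | ℓ.comp (transvectionHom i j) x = c})
    (h₂ : ∀ c, UnambiguousSemilinear {x | ℓ.comp (transvectionHom j i) x = c}) (c : ℤ) :
    UnambiguousSemilinear {x | ℓ x = c} := by
  have k₁ := (h₁ c).image 0 (transvectionHom i j)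
    (by simpa using (transvectionHom_injective hij).injOn)
  -- Translating by `e j` turns the weak inequality that describes the range of the transvection
  -- into the strict `x i < x j`, so that the two branches are disjoint.
  have k₂ := (h₂ (c - ℓ (Pi.single j 1))).image (Pi.single j 1) (transvectionHom j i)
    (fun x _ y _ h => transvectionHom_injective hij.symm (add_left_cancel h))
  convert union k₁ k₂ ?_ using 1
  · ext x
    simp only [Set.mem_ofPred_eq, Set.mem_union, Set.mem_image, AddMonoidHom.comp_apply, zero_add]
    constructor
    · intro hx
      by_cases hx' : x j ≤ x i
      · left
        obtain ⟨y, rfl⟩ : x ∈ Set.range (transvectionHom i j) := by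
          rw [range_transvectionHom hij]; exact hx'
        exact ⟨y, hx, rfl⟩
      · right
        obtain ⟨y, hy⟩ : x - Pi.single j 1 ∈ Set.range (transvectionHom j i) := by
          rw [range_transvectionHom hij.symm]
          simp [hij]
          omega
        have hxy : Pi.single j 1 + transvectionHom j i y = x := by
          rw [hy]
          ext k
          by_cases hk : k = j
          · subst hk; simp; omega
          · simp [hk]
        refine ⟨y, ?_, hxy⟩
        rw [← hxy, map_add] at hx
        linarith
    · rintro (⟨y, hy, rfl⟩ | ⟨y, hy, rfl⟩)
      · exact hy
      · rw [map_add, hy]; ring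
  · rw [Set.disjoint_left]
    rintro _ ⟨y, _, rfl⟩ ⟨z, _, hz⟩
    have hi := congrFun hz i
    have hj := congrFun hz j
    simp [transvectionHom_apply, hij, hij.symm] at hi hj
    omega

variable [Fintype κ]

theorem map_eq_sum_single {N : Type*} [AddCommMonoid N] (ℓ : (κ → ℕ) →+ N) (x : κ → ℕ) :
    ℓ x = ∑ i, x i • ℓ (Pi.single i 1) := by
  conv_lhs => rw [← Finset.univ_sum_single x]
  rw [map_sum]
  refine Finset.sum_congr rfl fun i _ => ?_
  rw [← map_nsmul, ← Pi.single_smul]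
  simp

/-- The extension by zero of functions supported on a subtype. -/
def extendHom (p : κ → Prop) [DecidablePred p] : ({i // p i} → ℕ) →+ (κ → ℕ) where
  toFun z i := if h : p i then z ⟨i, h⟩ else 0
  map_zero' := by ext i; simp
  map_add' y z := by ext i; by_cases h : p i <;> simp [h]

/-- Coordinates with positive coefficient are bounded by `c`, and those with coefficient zero are
unconstrained. Freezing the former by `π` leaves finitely many fibres, each empty or a translate of
a free monoid. -/
theorem UnambiguousSemilinear.setOf_eq_of_nonneg (ℓ : (κ → ℕ) →+ ℤ)
    (hℓ : ∀ i, 0 ≤ ℓ (Pi.single i 1)) (c : ℤ) : UnambiguousSemilinear {x | ℓ x = c} := by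
  set p : κ → Prop := fun i => ℓ (Pi.single i 1) = 0 with hp
  let π : (κ → ℕ) → (κ → ℕ) := fun x i => if p i then 0 else x i
  have hπ : ∀ x, ℓ (π x) = ℓ x := by
    intro x
    rw [map_eq_sum_single ℓ x, map_eq_sum_single ℓ (π x)]
    refine Finset.sum_congr rfl fun i _ => ?_
    by_cases h : p i
    · have h' : ℓ (Pi.single i 1) = 0 := h
      simp [h']
    · simp [π, h]
  refine of_fibers π (Finset.Iic fun _ => c.toNat) ?_ ?_
  · intro x hx
    rw [Finset.mem_Iic]
    intro i
    by_cases h : p i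
    · simp [π, h]
    · have h1 : 1 ≤ ℓ (Pi.single i 1) := by
        have : ℓ (Pi.single i 1) ≠ 0 := h
        have := hℓ i
        omega
      have h2 : (x i : ℤ) ≤ c := by
        rw [← show ℓ x = c from hx, map_eq_sum_single ℓ x]
        refine le_trans ?_ (Finset.single_le_sum
          (f := fun i => x i • ℓ (Pi.single i 1)) (fun j _ => ?_) (Finset.mem_univ i))
        · simp only [nsmul_eq_mul]
          nlinarith [Int.natCast_nonneg (x i)]
        · exact nsmul_nonneg (hℓ j) _
      simp only [π, h, if_false]
      omega
  · intro y _
    by_cases hy : ℓ y = c ∧ π y = y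
    · convert UnambiguousSemilinear.free y (extendHom p) ?_ using 1
      · ext x
        simp only [Set.mem_ofPred_eq, Set.mem_range]
        constructor
        · rintro ⟨_, rfl⟩
          refine ⟨fun i => x i, ?_⟩
          ext i
          by_cases h : p i <;> simp [extendHom, π, h]
        · rintro ⟨z, rfl⟩
          have key : π (y + extendHom p z) = y := by
            ext i
            have := congrFun hy.2 i
            by_cases h : p i
            · simpa [π, h] using this
            · simp [π, h, extendHom]
          exact ⟨by rw [← hπ, key, hy.1], key⟩
      · intro z w hzw
        have hzw' := add_left_cancel hzw
        ext ⟨i, hi⟩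
        have := congrFun hzw' i
        simpa [extendHom, hi] using this
    · convert UnambiguousSemilinear.empty using 1
      rw [Set.eq_empty_iff_forall_notMem]
      rintro x ⟨hx, rfl⟩
      refine hy ⟨by rw [hπ]; exact hx, ?_⟩
      ext i
      by_cases h : p i <;> simp [π, h]

/-- Termination of Elliott's reduction. With `lo ≤ hi`, pair a coefficient equal to `hi` with a
negative one: their sum lies in `[0, hi)` and replaces one of the two in each branch. So the number
of negative coefficients plus the number of maximal ones drops, until none is negative or `hi` can
be lowered. -/
theorem UnambiguousSemilinear.setOf_eq_of_bounds (s : ℕ) : ∀ (lo hi : ℕ), lo + hi ≤ s →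
    ∀ ℓ : (κ → ℕ) →+ ℤ, (∀ i, -(lo : ℤ) ≤ ℓ (Pi.single i 1) ∧ ℓ (Pi.single i 1) ≤ hi) →
    ∀ c, UnambiguousSemilinear {x | ℓ x = c} := by
  induction s with
  | zero =>
    intro lo hi h ℓ hℓ c
    exact setOf_eq_of_nonneg ℓ (fun i => by have := (hℓ i).1; omega) c
  | succ s ih =>
    have main : ∀ (k lo hi : ℕ), lo ≤ hi → lo + hi ≤ s + 1 → ∀ ℓ : (κ → ℕ) →+ ℤ,
        (∀ i, -(lo : ℤ) ≤ ℓ (Pi.single i 1) ∧ ℓ (Pi.single i 1) ≤ hi) →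
        (Finset.univ.filter fun i => ℓ (Pi.single i 1) < 0).card +
          (Finset.univ.filter fun i => ℓ (Pi.single i 1) = hi).card ≤ k →
        ∀ c, UnambiguousSemilinear {x | ℓ x = c} := by
      intro k
      induction k with
      | zero =>
        intro lo hi _ _ ℓ _ hk c
        refine setOf_eq_of_nonneg ℓ (fun i => ?_) c
        have : (Finset.univ.filter fun i => ℓ (Pi.single i 1) < 0).card = 0 := by omega
        rw [Finset.card_eq_zero, Finset.filter_eq_empty_iff] at this
        simpa using this (Finset.mem_univ i)
      | succ k ihk =>
        intro lo hi hlh hs ℓ hℓ hk c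
        by_cases hneg : ∀ i, 0 ≤ ℓ (Pi.single i 1)
        · exact setOf_eq_of_nonneg ℓ hneg c
        push Not at hneg
        obtain ⟨j, hj⟩ := hneg
        have hpos : 0 < hi := by
          have := (hℓ j).1
          omega
        by_cases hmax : ∃ i, ℓ (Pi.single i 1) = hi
        · obtain ⟨i, hi'⟩ := hmax
          have hij : i ≠ j := by
            rintro rfl
            omega
          have hjl := (hℓ j).1
          refine setOf_eq_of_transvection ℓ hij ?_ ?_ c
          · refine ihk lo hi hlh hs _ ?_ ?_
            · intro m
              rw [AddMonoidHom.comp_apply, map_transvectionHom_single]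
              split_ifs
              · omega
              · exact hℓ m
            · have h1 : (Finset.univ.filter fun m =>
                  (ℓ.comp (transvectionHom i j)) (Pi.single m 1) < 0) ⊂
                  (Finset.univ.filter fun m => ℓ (Pi.single m 1) < 0) := by
                rw [Finset.ssubset_iff_of_subset]
                · exact ⟨j, by simpa using hj, by
                    simp [map_transvectionHom_single]; omega⟩
                · intro m
                  simp only [Finset.mem_filter, Finset.mem_univ, true_and,
                    AddMonoidHom.comp_apply, map_transvectionHom_single]
                  split_ifs <;> omega
              have h2 : (Finset.univ.filter fun m =>
                  (ℓ.comp (transvectionHom i j)) (Pi.single m 1) = hi) ⊆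
                  (Finset.univ.filter fun m => ℓ (Pi.single m 1) = hi) := by
                intro m
                simp only [Finset.mem_filter, Finset.mem_univ, true_and,
                  AddMonoidHom.comp_apply, map_transvectionHom_single]
                split_ifs <;> omega
              have := Finset.card_lt_card h1
              have := Finset.card_le_card h2
              omega
          · refine ihk lo hi hlh hs _ ?_ ?_
            · intro m
              rw [AddMonoidHom.comp_apply, map_transvectionHom_single]
              split_ifs
              · omega
              · exact hℓ m
            · have h1 : (Finset.univ.filter fun m =>
                  (ℓ.comp (transvectionHom j i)) (Pi.single m 1) = hi) ⊂
                  (Finset.univ.filter fun m => ℓ (Pi.single m 1) = hi) := by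
                rw [Finset.ssubset_iff_of_subset]
                · exact ⟨i, by simpa using hi', by
                    simp [map_transvectionHom_single]; omega⟩
                · intro m
                  simp only [Finset.mem_filter, Finset.mem_univ, true_and,
                    AddMonoidHom.comp_apply, map_transvectionHom_single]
                  split_ifs <;> omega
              have h2 : (Finset.univ.filter fun m =>
                  (ℓ.comp (transvectionHom j i)) (Pi.single m 1) < 0) ⊆
                  (Finset.univ.filter fun m => ℓ (Pi.single m 1) < 0) := by
                intro m
                simp only [Finset.mem_filter, Finset.mem_univ, true_and,
                  AddMonoidHom.comp_apply, map_transvectionHom_single]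
                split_ifs <;> omega
              have := Finset.card_lt_card h1
              have := Finset.card_le_card h2
              omega
        · push Not at hmax
          refine ih lo (hi - 1) (by omega) ℓ (fun i => ⟨(hℓ i).1, ?_⟩) c
          have := (hℓ i).2
          have := hmax i
          omega
    intro lo hi h ℓ hℓ c
    rcases le_total lo hi with hle | hle
    · exact main _ lo hi hle h ℓ hℓ le_rfl c
    -- Negating the equation exchanges the two bounds.
    · have := main _ hi lo hle (by omega) (-ℓ) (fun i => by
        have := hℓ i
        simp only [AddMonoidHom.neg_apply]
        omega) le_rfl (-c)
      simpa using this

theorem UnambiguousSemilinear.setOf_eq_pi (ℓ : (κ → ℕ) →+ ℤ) (c : ℤ) :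
    UnambiguousSemilinear {x | ℓ x = c} := by
  set B := ∑ i, (ℓ (Pi.single i 1)).natAbs
  have hB : ∀ i, (ℓ (Pi.single i 1)).natAbs ≤ B := fun i =>
    Finset.single_le_sum (f := fun i => (ℓ (Pi.single i 1)).natAbs) (fun _ _ => Nat.zero_le _)
      (Finset.mem_univ i)
  refine setOf_eq_of_bounds _ B B le_rfl ℓ (fun i => ?_) c
  have := hB i
  omega

/-- Forgetting the coordinate `none`. -/
def forgetNoneHom (κ : Type) : (Option κ → ℕ) →+ (κ → ℕ) where
  toFun y i := y (some i)
  map_zero' := rfl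
  map_add' _ _ := rfl

/-- The coordinate `none` is a slack variable; it is determined by the others, so forgetting it is
injective on the solutions. -/
theorem UnambiguousSemilinear.setOf_le_pi (ℓ : (κ → ℕ) →+ ℤ) (c : ℤ) :
    UnambiguousSemilinear {x | c ≤ ℓ x} := by
  set ℓ' : (Option κ → ℕ) →+ ℤ := ℓ.comp (forgetNoneHom κ) -
    (Nat.castAddMonoidHom ℤ).comp (Pi.evalAddMonoidHom _ none)
  have hℓ' : ∀ y, ℓ' y = ℓ (fun i => y (some i)) - y none := fun y => rfl
  convert (setOf_eq_pi ℓ' c).image 0 (forgetNoneHom κ) ?_ using 1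
  · ext x
    simp only [Set.mem_ofPred_eq, Set.mem_image, zero_add, hℓ']
    constructor
    · intro hx
      refine ⟨fun o => o.elim (ℓ x - c).toNat x, ?_, rfl⟩
      change ℓ x - ((ℓ x - c).toNat : ℤ) = c
      omega
    · rintro ⟨y, hy, rfl⟩
      have : forgetNoneHom κ y = fun i => y (some i) := rfl
      rw [this]
      omega
  · intro y hy z hz h
    simp only [zero_add] at h
    have h' : (fun i => y (some i)) = fun i => z (some i) := h
    simp only [Set.mem_ofPred_eq, hℓ', h'] at hy hz
    ext o
    cases o with
    | none => omega
    | some i => exact congrFun h' i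

end LinearEquation

theorem UnambiguousSemilinear.inter_setOf_le {M : Type*} [AddCommMonoid M] {T : Set M}
    (hT : UnambiguousSemilinear T) (ℓ : M →+ ℤ) (c : ℤ) :
    UnambiguousSemilinear (T ∩ {x | c ≤ ℓ x}) := by
  classical
  induction hT with
  | empty => simpa using empty
  | @free κ _ b φ h =>
    have := Fintype.ofFinite κ
    convert (setOf_le_pi (ℓ.comp φ) (c - ℓ b)).image b φ h.injOn using 1
    ext x
    constructor
    · rintro ⟨⟨y, rfl⟩, hy⟩
      refine ⟨y, ?_, rfl⟩
      simp only [Set.mem_ofPred_eq, map_add] at hy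
      simp only [Set.mem_ofPred_eq, AddMonoidHom.comp_apply]
      omega
    · rintro ⟨y, hy, rfl⟩
      refine ⟨⟨y, rfl⟩, ?_⟩
      simp only [Set.mem_ofPred_eq, AddMonoidHom.comp_apply] at hy
      simp only [Set.mem_ofPred_eq, map_add]
      omega
  | union hs ht hd ihs iht =>
    rw [Set.union_inter_distrib_right]
    exact union ihs iht (hd.mono Set.inter_subset_left Set.inter_subset_left)

/-! ### Boolean combinations of affine inequalities -/

/-- A predicate cutting every unambiguous semilinear set into two such sets. -/
def SplitsSemilinear {M : Type*} [AddCommMonoid M] (P : M → Prop) : Prop :=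
  ∀ T, UnambiguousSemilinear T →
    UnambiguousSemilinear (T ∩ {x | P x}) ∧ UnambiguousSemilinear (T ∩ {x | ¬ P x})

/-- A map that is the sum of a constant and an additive homomorphism to `ℤ`. -/
def IsIntAffine {M : Type*} [AddCommMonoid M] (u : M → ℤ) : Prop :=
  ∃ (b : ℤ) (φ : M →+ ℤ), ∀ x, u x = b + φ x

section Splits

variable {M : Type*} [AddCommMonoid M]

namespace IsIntAffine

theorem const (c : ℤ) : IsIntAffine fun _ : M => c := ⟨c, 0, by simp⟩

theorem natCast_hom (φ : M →+ ℕ) : IsIntAffine fun x => (φ x : ℤ) :=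
  ⟨0, (Nat.castAddMonoidHom ℤ).comp φ, by simp⟩

theorem add {u v : M → ℤ} (hu : IsIntAffine u) (hv : IsIntAffine v) :
    IsIntAffine fun x => u x + v x := by
  obtain ⟨b, φ, h⟩ := hu
  obtain ⟨c, ψ, k⟩ := hv
  exact ⟨b + c, φ + ψ, fun x => by simp only [h, k, AddMonoidHom.add_apply]; ring⟩

end IsIntAffine

namespace SplitsSemilinear

variable {P Q : M → Prop}

theorem not (hP : SplitsSemilinear P) : SplitsSemilinear fun x => ¬ P x := fun T hT =>
  ⟨(hP T hT).2, by simpa using (hP T hT).1⟩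

/-- The complement is the disjoint union of `¬ P` and `P ∧ ¬ Q`. Splitting arbitrary `T`, not just
the whole space, lets the cuts be made one after another. -/
theorem and (hP : SplitsSemilinear P) (hQ : SplitsSemilinear Q) :
    SplitsSemilinear fun x => P x ∧ Q x := by
  intro T hT
  constructor
  · convert (hQ _ (hP T hT).1).1 using 1
    ext x; simp only [Set.mem_inter_iff, Set.mem_ofPred_eq]; tauto
  · convert UnambiguousSemilinear.union (hP T hT).2 (hQ _ (hP T hT).1).2 ?_ using 1
    · ext x; simp only [Set.mem_inter_iff, Set.mem_union, Set.mem_ofPred_eq]; tauto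
    · rw [Set.disjoint_left]
      rintro x ⟨_, h⟩ ⟨⟨_, h'⟩, _⟩
      exact h h'

theorem congr (hP : SplitsSemilinear P) (h : ∀ x, Q x ↔ P x) : SplitsSemilinear Q := by
  have : Q = P := funext fun x => propext (h x)
  rwa [this]

theorem imp (hP : SplitsSemilinear P) (hQ : SplitsSemilinear Q) :
    SplitsSemilinear fun x => P x → Q x :=
  (hP.and hQ.not).not.congr fun x => by tauto

theorem true : SplitsSemilinear fun _ : M => True := fun T hT =>
  ⟨by simpa using hT, by simpa using UnambiguousSemilinear.empty⟩

theorem forall_fintype {ι : Type*} [Fintype ι] {P : ι → M → Prop}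
    (h : ∀ i, SplitsSemilinear (P i)) : SplitsSemilinear fun x => ∀ i, P i x := by
  classical
  suffices H : ∀ s : Finset ι, SplitsSemilinear fun x => ∀ i ∈ s, P i x from
    (H Finset.univ).congr fun x => by simp
  intro s
  induction s using Finset.induction_on with
  | empty => exact true.congr fun x => by simp
  | insert i s _ ih => exact ((h i).and ih).congr fun x => by simp

theorem const (p : Prop) : SplitsSemilinear fun _ : M => p := by
  by_cases h : p
  · exact true.congr fun _ => by simp [h]
  · exact true.not.congr fun _ => by simp [h]

theorem exists_fintype {ι : Type*} [Fintype ι] {P : ι → M → Prop}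
    (h : ∀ i, SplitsSemilinear (P i)) : SplitsSemilinear fun x => ∃ i, P i x :=
  (forall_fintype fun i => (h i).not).not.congr fun x => by simp

theorem le {u v : M → ℤ} (hu : IsIntAffine u) (hv : IsIntAffine v) :
    SplitsSemilinear fun x => u x ≤ v x := by
  obtain ⟨b, φ, h⟩ := hu
  obtain ⟨c, ψ, k⟩ := hv
  intro T hT
  constructor
  · convert hT.inter_setOf_le (ψ - φ) (b - c) using 2
    ext x
    simp only [h, k, AddMonoidHom.sub_apply, Set.mem_ofPred_eq]
    omega
  · convert hT.inter_setOf_le (φ - ψ) (c - b + 1) using 2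
    ext x
    simp only [h, k, AddMonoidHom.sub_apply, Set.mem_ofPred_eq]
    omega

theorem lt {u v : M → ℤ} (hu : IsIntAffine u) (hv : IsIntAffine v) :
    SplitsSemilinear fun x => u x < v x :=
  (le hv hu).not.congr fun x => by simp

theorem eq {u v : M → ℤ} (hu : IsIntAffine u) (hv : IsIntAffine v) :
    SplitsSemilinear fun x => u x = v x :=
  ((le hu hv).and (le hv hu)).congr fun _ => le_antisymm_iff

end SplitsSemilinear

end Splits

/-! ### Eventual quasipolynomials and difference equations -/

open Polynomial in
/-- Eventual agreement with a function that is polynomial on each residue class. -/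
def EventuallyQuasipolynomial (f : ℕ → ℚ) : Prop :=
  ∃ N : ℕ, 0 < N ∧ ∃ p : ℕ → ℚ[X], Function.Periodic p N ∧
    ∀ᶠ n in Filter.atTop, f n = (p n).eval (n : ℚ)

open Polynomial in
-- Bernoulli polynomials are antidifferences of monomials, up to a scalar.
theorem Polynomial.exists_eval_add_one_eq (q : ℚ[X]) :
    ∃ Q : ℚ[X], ∀ x, Q.eval (x + 1) = Q.eval x + q.eval x := by
  induction q using Polynomial.induction_on' with
  | add p q hp hq =>
    obtain ⟨P, hP⟩ := hp
    obtain ⟨Q, hQ⟩ := hq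
    exact ⟨P + Q, fun x => by simp only [eval_add, hP, hQ]; ring⟩
  | monomial n a =>
    refine ⟨C (a / (n + 1)) * bernoulli (n + 1), fun x => ?_⟩
    have h : ((n : ℚ) + 1) ≠ 0 := by positivity
    rw [add_comm x 1, eval_mul, eval_mul, bernoulli_eval_one_add]
    simp
    field_simp

open Polynomial in
theorem Polynomial.exists_eval_add_eq (q : ℚ[X]) {N : ℕ} (hN : 0 < N) :
    ∃ Q : ℚ[X], ∀ x : ℚ, Q.eval (x + N) = Q.eval x + q.eval x := by
  have hN' : (N : ℚ) ≠ 0 := by positivity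
  obtain ⟨Q, hQ⟩ := exists_eval_add_one_eq (q.comp (C (N : ℚ) * X))
  refine ⟨Q.comp (C (N : ℚ)⁻¹ * X), fun x => ?_⟩
  have := hQ ((N : ℚ)⁻¹ * x)
  simp only [eval_comp, eval_mul, eval_C, eval_X] at this ⊢
  rw [mul_add, inv_mul_cancel₀ hN', this, mul_inv_cancel_left₀ hN']

namespace EventuallyQuasipolynomial

open Polynomial Filter

theorem congr' {f h : ℕ → ℚ} (hh : EventuallyQuasipolynomial h) (e : ∀ᶠ n in atTop, f n = h n) :
    EventuallyQuasipolynomial f := by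
  obtain ⟨N, hN, p, hp, hf⟩ := hh
  exact ⟨N, hN, p, hp, by filter_upwards [e, hf] with n h1 h2; rw [h1, h2]⟩

theorem zero : EventuallyQuasipolynomial fun _ => 0 :=
  ⟨1, one_pos, fun _ => 0, fun _ => rfl, by simp⟩

theorem add {f h : ℕ → ℚ} (hf : EventuallyQuasipolynomial f) (hh : EventuallyQuasipolynomial h) :
    EventuallyQuasipolynomial fun n => f n + h n := by
  obtain ⟨N, hN, p, hp, hf⟩ := hf
  obtain ⟨K, hK, q, hq, hh⟩ := hh
  refine ⟨N * K, Nat.mul_pos hN hK, fun n => p n + q n, ?_, ?_⟩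
  · have h1 : Function.Periodic p (N * K) := by rw [mul_comm]; simpa using hp.nat_mul K
    have h2 : Function.Periodic q (N * K) := by simpa using hq.nat_mul N
    intro n
    simp only [h1 n, h2 n]
  · filter_upwards [hf, hh] with n h1 h2
    simp [h1, h2]

theorem comp_add {f : ℕ → ℚ} (hf : EventuallyQuasipolynomial f) (k : ℕ) :
    EventuallyQuasipolynomial fun n => f (n + k) := by
  obtain ⟨N, hN, p, hp, hf⟩ := hf
  refine ⟨N, hN, fun n => (p (n + k)).comp (X + C (k : ℚ)), fun n => ?_, ?_⟩
  · simp only [add_right_comm n N k, hp (n + k)]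
  · filter_upwards [(tendsto_add_atTop_nat k).eventually hf] with n hn
    simp [hn]

theorem of_comp_add {f : ℕ → ℚ} (k : ℕ) (hf : EventuallyQuasipolynomial fun n => f (n + k)) :
    EventuallyQuasipolynomial f := by
  obtain ⟨N, hN, p, hp, hf⟩ := hf
  -- Adding `k * (N - 1)` stands for subtracting `k` modulo the period `N`, without truncated
  -- subtraction.
  refine ⟨N, hN, fun n => (p (n + k * (N - 1))).comp (X - C (k : ℚ)), fun n => ?_, ?_⟩
  · simp only [add_right_comm n N _, hp (n + k * (N - 1))]
  · have hpk : Function.Periodic p (k * N) := by simpa using hp.nat_mul k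
    rw [eventually_atTop] at hf ⊢
    obtain ⟨n₀, hn₀⟩ := hf
    refine ⟨n₀ + k, fun n hn => ?_⟩
    obtain ⟨m, rfl⟩ : ∃ m, n = m + k := ⟨n - k, by omega⟩
    have e : m + k + k * (N - 1) = m + k * N := by
      obtain ⟨L, rfl⟩ : ∃ L, N = L + 1 := ⟨N - 1, by omega⟩
      simp; ring
    simp only [e, hpk m]
    rw [show f (m + k) = _ from hn₀ m (by omega)]
    simp

/-- Subtracting from `f` an antidifference of `p n` with step `L` leaves a remainder `D` that is
eventually `L`-periodic, since `p` does not change along a step. -/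
theorem of_add_eq_aux {f : ℕ → ℚ} {p : ℕ → ℚ[X]} {L n₀ : ℕ} (hL : 0 < L)
    (hp : Function.Periodic p L) (h : ∀ n ≥ n₀, f (n + L) = f n + (p n).eval (n : ℚ)) :
    EventuallyQuasipolynomial f := by
  choose Q hQ using fun q : ℚ[X] => Polynomial.exists_eval_add_eq q hL
  set D : ℕ → ℚ := fun n => f n - (Q (p n)).eval (n : ℚ) with hD
  have hDL : ∀ n ≥ n₀, D (n + L) = D n := by
    intro n hn
    simp only [hD, hp n, h n hn, Nat.cast_add, hQ]
    ring
  have hDk : ∀ ρ k, n₀ ≤ k → D (ρ + L * k) = D (ρ + L * n₀) := by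
    intro ρ k hk
    induction k, hk using Nat.le_induction with
    | base => rfl
    | succ k hk ih =>
      rw [← ih, Nat.mul_succ, ← add_assoc]
      refine hDL _ ?_
      have := Nat.le_mul_of_pos_left k hL
      omega
  -- The argument `n % L + L * n₀` is a representative of the class of `n` already in the range
  -- where `D` is periodic.
  refine ⟨L, hL, fun n => Q (p n) + C (D (n % L + L * n₀)), fun n => ?_, ?_⟩
  · simp only [hp n, Nat.add_mod_right]
  · filter_upwards [eventually_ge_atTop (L * n₀)] with n hn
    have h1 : D n = D (n % L + L * n₀) := by
      rw [← hDk (n % L) (n / L) ((Nat.le_div_iff_mul_le hL).2 (by rwa [mul_comm])), Nat.mod_add_div]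
    rw [eval_add, eval_C, ← h1]
    simp only [hD]
    ring

theorem of_add_eq {f h : ℕ → ℚ} {w : ℕ} (hw : 0 < w) (hh : EventuallyQuasipolynomial h)
    (hf : ∀ n, f (n + w) = f n + h n) : EventuallyQuasipolynomial f := by
  obtain ⟨N, hN, p, hp, hpe⟩ := hh
  have hiter : ∀ K n, f (n + K * w) = f n + ∑ j ∈ Finset.range K, h (n + j * w) := by
    intro K n
    induction K with
    | zero => simp
    | succ K ih =>
      rw [Finset.sum_range_succ, ← add_assoc, ← ih, ← hf]
      congr 1
      ring
  obtain ⟨n₀, hn₀⟩ := eventually_atTop.1 hpe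
  -- Iterating the recurrence `N` times gives the step `N * w`, a multiple of the period of `p`.
  refine of_add_eq_aux (p := fun n => ∑ j ∈ Finset.range N, (p (n + j * w)).comp
    (X + C ((j * w : ℕ) : ℚ))) (Nat.mul_pos hN hw) (fun n => ?_) (n₀ := n₀) fun n hn => ?_
  · have hpw : Function.Periodic p (N * w) := by rw [mul_comm]; simpa using hp.nat_mul w
    refine Finset.sum_congr rfl fun j _ => ?_
    rw [add_right_comm, hpw]
  · rw [hiter N n, eval_finsetSum]
    congr 1
    refine Finset.sum_congr rfl fun j _ => ?_
    rw [hn₀ _ (by omega)]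
    simp

end EventuallyQuasipolynomial

/-! ### Counting the points of a semilinear set by level -/

section Counting

variable {κ : Type} [Fintype κ]

theorem Set.finite_setOf_map_eq (w : (κ → ℕ) →+ ℕ) [DecidableEq κ]
    (hw : ∀ i, 0 < w (Pi.single i 1)) (n : ℕ) : {y | w y = n}.Finite := by
  refine (Set.finite_Iic fun _ : κ => n).subset fun y hy i => ?_
  rw [← show w y = n from hy, map_eq_sum_single w y]
  refine le_trans ?_ (Finset.single_le_sum (f := fun i => y i • w (Pi.single i 1))
    (fun _ _ => Nat.zero_le _) (Finset.mem_univ i))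
  exact Nat.le_mul_of_pos_right _ (hw i)

/-- Induction on the allowed support. Solutions at level `n + w (e i)` either have `y i = 0`, hence
smaller support, or come from level `n` by adding `e i`; this is a difference equation with step `w
(e i)`. -/
theorem EventuallyQuasipolynomial.ncard_setOf_map_eq (w : (κ → ℕ) →+ ℕ) [DecidableEq κ]
    (hw : ∀ i, 0 < w (Pi.single i 1)) :
    EventuallyQuasipolynomial fun n => ({y | w y = n}.ncard : ℚ) := by
  suffices H : ∀ s : Finset κ, EventuallyQuasipolynomial
      fun n => ({y | (∀ j ∉ s, y j = 0) ∧ w y = n}.ncard : ℚ) by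
    simpa using H Finset.univ
  have hfin : ∀ (s : Finset κ) n, {y | (∀ j ∉ s, y j = 0) ∧ w y = n}.Finite := fun s n =>
    (Set.finite_setOf_map_eq w hw n).subset fun y hy => hy.2
  intro s
  induction s using Finset.induction_on with
  | empty =>
    refine zero.congr' ?_
    filter_upwards [Filter.eventually_gt_atTop 0] with n hn
    rw [Nat.cast_eq_zero, Set.ncard_eq_zero (hfin _ _), Set.eq_empty_iff_forall_notMem]
    rintro y ⟨hy, rfl⟩
    have : y = 0 := by ext j; simpa using hy j
    simp [this] at hn
  | insert i s hi ih =>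
    refine of_add_eq (hw i) (ih.comp_add (w (Pi.single i 1))) fun n => ?_
    norm_cast
    have hinj : Function.Injective fun y : κ → ℕ => y + Pi.single i 1 :=
      add_left_injective _
    rw [← Set.ncard_image_of_injective {y | (∀ j ∉ insert i s, y j = 0) ∧ w y = n} hinj,
      ← Set.ncard_union_eq _ ((hfin _ _).image _) (hfin _ _)]
    · congr 1
      ext y
      simp only [Finset.mem_insert, not_or, Set.mem_ofPred_eq, Set.mem_union, Set.mem_image]
      constructor
      · rintro ⟨h1, h2⟩
        by_cases hyi : y i = 0
        · right
          refine ⟨fun j hj => ?_, h2⟩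
          by_cases hji : j = i
          · rw [hji, hyi]
          · exact h1 j ⟨hji, hj⟩
        · left
          have e : (y - Pi.single i 1) + Pi.single i 1 = y := by
            ext j
            by_cases hji : j = i
            · subst hji; simp; omega
            · simp [hji]
          refine ⟨y - Pi.single i 1, ⟨fun j hj => ?_, ?_⟩, e⟩
          · simp [h1 j hj]
          · rw [← e, map_add] at h2
            omega
      · rintro (⟨y, ⟨h1, rfl⟩, rfl⟩ | ⟨h1, h2⟩)
        · refine ⟨fun j hj => ?_, map_add _ _ _⟩
          simp [h1 j hj, hj.1]
        · exact ⟨fun j hj => h1 j hj.2, h2⟩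
    · rw [Set.disjoint_left]
      rintro _ ⟨y, _, rfl⟩ ⟨h, _⟩
      simpa using h i hi

end Counting

theorem UnambiguousSemilinear.eventuallyQuasipolynomial_ncard {M : Type*} [AddCommMonoid M]
    (γ : M →+ ℕ) {T : Set M} (hT : UnambiguousSemilinear T)
    (hfin : ∀ n, {x | x ∈ T ∧ γ x = n}.Finite) :
    EventuallyQuasipolynomial fun n => ({x | x ∈ T ∧ γ x = n}.ncard : ℚ) := by
  classical
  induction hT with
  | empty => simpa using EventuallyQuasipolynomial.zero
  | @free κ _ b φ h =>
    have := Fintype.ofFinite κ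
    have himage : ∀ n, {x | x ∈ Set.range (fun y => b + φ y) ∧ γ x = n} =
        (fun y => b + φ y) '' {y | γ b + γ (φ y) = n} := by
      intro n
      ext x
      constructor
      · rintro ⟨⟨y, rfl⟩, hy⟩
        exact ⟨y, by simpa using hy, rfl⟩
      · rintro ⟨y, hy, rfl⟩
        exact ⟨⟨y, rfl⟩, by simpa using hy⟩
    -- A generator of weight zero would put all its multiples into one fibre, contradicting
    -- finiteness.
    have hw : ∀ i, 0 < γ.comp φ (Pi.single i 1) := by
      intro i
      rw [Nat.pos_iff_ne_zero]
      intro hi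
      have h1 := hfin (γ b)
      rw [himage] at h1
      have h2 := h1.of_finite_image h.injOn
      refine Set.infinite_of_injective_forall_mem (f := fun k : ℕ => (Pi.single i k : κ → ℕ))
        (Pi.single_injective (M := fun _ => ℕ) i) (fun k => ?_) h2
      have e : (Pi.single i k : κ → ℕ) = k • Pi.single i 1 := by
        rw [← Pi.single_smul]; simp
      rw [AddMonoidHom.comp_apply] at hi
      rw [Set.mem_ofPred_eq, e, map_nsmul, map_nsmul, hi, smul_zero, add_zero]
    refine EventuallyQuasipolynomial.of_comp_add (γ b)
      ((EventuallyQuasipolynomial.ncard_setOf_map_eq (γ.comp φ) hw).congr' (.of_forall fun n => ?_))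
    rw [himage, Set.ncard_image_of_injective _ h]
    congr 3
    ext y
    simp only [AddMonoidHom.comp_apply]
    omega
  | @union s t _ _ hd ihs iht =>
    have e : ∀ n, {x | x ∈ s ∪ t ∧ γ x = n} = {x | x ∈ s ∧ γ x = n} ∪ {x | x ∈ t ∧ γ x = n} := by
      intro n
      ext x
      simp only [Set.mem_union, Set.mem_ofPred_eq]
      tauto
    have hs : ∀ n, {x | x ∈ s ∧ γ x = n}.Finite := fun n =>
      (hfin n).subset fun x hx => ⟨Or.inl hx.1, hx.2⟩
    have ht : ∀ n, {x | x ∈ t ∧ γ x = n}.Finite := fun n =>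
      (hfin n).subset fun x hx => ⟨Or.inr hx.1, hx.2⟩
    refine ((ihs hs).add (iht ht)).congr' (.of_forall fun n => ?_)
    rw [e, Set.ncard_union_eq _ (hs n) (ht n)]
    · push_cast; rfl
    · exact hd.mono (fun x hx => hx.1) (fun x hx => hx.1)

/-! ### Reading the degree off growth bounds -/

open Polynomial Filter in
-- The upper bound limits the degree on every residue class. The lower bound is needed only on class
-- `0`, where it forces degree `d`.
theorem EventuallyQuasipolynomial.isEventuallyQuasipolynomialOfDegree {f : ℕ → ℕ} {d K : ℕ}
    (hK : 0 < K) (hf : EventuallyQuasipolynomial fun n => (f n : ℚ))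
    (hup : ∀ n, f n ≤ (2 * n + 1) ^ d) (hlow : ∀ k, k ^ d ≤ f (K * k)) :
    IsEventuallyQuasipolynomialOfDegree f d := by
  obtain ⟨N, hN, p, hp, hfp⟩ := hf
  have hNt : ∀ ρ, Tendsto (fun t : ℕ => ((ρ + N * t : ℕ) : ℚ)) atTop atTop := fun ρ =>
    tendsto_natCast_atTop_atTop.comp (tendsto_atTop_mono
      (fun t => (Nat.le_mul_of_pos_left t hN).trans (Nat.le_add_left _ _)) tendsto_id)
  have hNt' : ∀ ρ, Tendsto (fun t : ℕ => (ρ + N * t : ℕ)) atTop atTop := fun ρ =>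
    tendsto_natCast_atTop_iff.1 (hNt ρ)
  have hpt : ∀ ρ t, p (ρ + N * t) = p ρ := fun ρ t => by
    have := hp.nat_mul t
    rw [mul_comm]
    simpa using this ρ
  have hdeg : ∀ ρ, (p ρ).degree ≤ d := by
    intro ρ
    by_contra! hlt
    set R : ℚ[X] := (C 2 * X + C 1) ^ d with hR
    have hlin : (C (2 : ℚ) * X + C 1).degree = 1 := degree_linear two_ne_zero
    have hRd : R.degree = d := by
      rw [hR, degree_pow, hlin]; simp
    have hR0 : R ≠ 0 := by
      rw [hR]; exact pow_ne_zero _ fun h => by rw [h] at hlin; simp at hlin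
    have h1 := (Polynomial.abs_div_tendsto_atTop_atTop_of_degree_gt (p ρ) R (by rwa [hRd]) hR0).comp
      (hNt ρ)
    obtain ⟨t, ht1, ht2⟩ := ((h1.eventually_gt_atTop 1).and ((hNt' ρ).eventually hfp)).exists
    rw [hpt] at ht2
    simp only [Function.comp_apply] at ht1
    rw [← ht2] at ht1
    have hpos : 0 < R.eval ((ρ + N * t : ℕ) : ℚ) := by
      simp only [hR, eval_pow, eval_add, eval_mul, eval_C, eval_X]
      positivity
    have hle : (f (ρ + N * t) : ℚ) ≤ R.eval ((ρ + N * t : ℕ) : ℚ) := by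
      simp only [hR, eval_pow, eval_add, eval_mul, eval_C, eval_X]
      exact_mod_cast hup (ρ + N * t)
    rw [abs_of_nonneg (by positivity), lt_div_iff₀ hpos] at ht1
    linarith
  refine ⟨fun n => (p n).eval (n : ℚ), ⟨fun i n => (p n).coeff i, fun i => ⟨N, hN, fun n => ?_⟩,
    ?_, fun t => ?_⟩, hfp⟩
  · simp only [hp n]
  · intro h0
    have hlt : (p 0).degree < ((X : ℚ[X]) ^ d).degree := by
      rw [degree_X_pow]
      refine lt_of_le_of_ne (hdeg 0) fun h => ?_
      exact coeff_ne_zero_of_eq_degree h (congrFun h0 0)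
    -- Arguments `N * K * t` lie in class `0` and are also covered by `hlow`; there `f n / n ^ d` is
    -- at least `(K ^ d)⁻¹`, so it cannot tend to `0`.
    have hKt : Tendsto (fun t : ℕ => K * t) atTop atTop :=
      tendsto_atTop_mono (fun t => Nat.le_mul_of_pos_left t hK) tendsto_id
    have h1 := ((Polynomial.div_tendsto_atTop_zero_of_degree_lt (p 0) _ hlt).comp (hNt 0)).comp hKt
    have hc : (0 : ℚ) < ((K : ℚ) ^ d)⁻¹ := by positivity
    obtain ⟨t, ⟨ht1, ht2⟩, ht3⟩ := (((h1.eventually_lt_const hc).and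
      (hKt.eventually ((hNt' 0).eventually hfp))).and (eventually_gt_atTop 0)).exists
    rw [hpt] at ht2
    simp only [Function.comp_apply] at ht1
    rw [← ht2] at ht1
    have e : 0 + N * (K * t) = K * (N * t) := by ring
    have h2 := hlow (N * t)
    have h3 : ((N * t : ℕ) : ℚ) ^ d ≤ f (K * (N * t)) := by exact_mod_cast h2
    have h4 : (0 : ℚ) < ((N * t : ℕ) : ℚ) := by positivity
    simp only [e, eval_pow, eval_X] at ht1
    rw [Nat.cast_mul, mul_pow, div_lt_iff₀ (by positivity), inv_mul_cancel_left₀ (by positivity)]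
      at ht1
    linarith
  · simp only
    rw [eval_eq_sum_range' (n := d + 1) (Nat.lt_succ_of_le (natDegree_le_of_degree_le (hdeg t))),
      Finset.sum_range]

/-! ### The ordinarization number as a count of small elements -/

namespace NumericalSemigroup

/-- `A` contains `0`, has exactly `g` gaps, and has exactly `k` positive elements up to `g`. -/
structure HasSmallElements (g k : ℕ) (A : Set ℕ) : Prop where
  zero_mem : 0 ∈ A
  finite : {n | n ∉ A}.Finite
  ncard_gaps : {n | n ∉ A}.ncard = g
  ncard_small : {n | n ∈ A ∧ 1 ≤ n ∧ n ≤ g}.ncard = k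

namespace HasSmallElements

variable {g k : ℕ} {A : Set ℕ}

theorem finite_small (g : ℕ) (A : Set ℕ) : {n | n ∈ A ∧ 1 ≤ n ∧ n ≤ g}.Finite :=
  (Set.finite_Icc 1 g).subset fun _ h => h.2

/-- The interval `[1, g]` has as many elements as there are gaps; removing the gaps up to `g` from
both leaves `k` elements on each side. -/
theorem ncard_large (h : HasSmallElements g k A) : {n | n ∉ A ∧ g < n}.ncard = k := by
  have h1 : {n | n ∉ A ∧ n ≤ g}.Finite := h.finite.subset fun _ h => h.1
  have h2 : {n | n ∉ A ∧ g < n}.Finite := h.finite.subset fun _ h => h.1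
  have e1 := Set.ncard_union_eq (s := {n | n ∈ A ∧ 1 ≤ n ∧ n ≤ g}) (t := {n | n ∉ A ∧ n ≤ g})
    (Set.disjoint_left.2 fun n hn hn' => hn'.1 hn.1) (finite_small g A) h1
  have e2 := Set.ncard_union_eq (s := {n | n ∉ A ∧ n ≤ g}) (t := {n | n ∉ A ∧ g < n})
    (Set.disjoint_left.2 fun n hn hn' => absurd hn.2 (not_le.2 hn'.2)) h1 h2
  have u1 : {n | n ∈ A ∧ 1 ≤ n ∧ n ≤ g} ∪ {n | n ∉ A ∧ n ≤ g} = Finset.Icc 1 g := by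
    ext n
    simp only [Set.mem_union, Set.mem_ofPred_eq, Finset.coe_Icc, Set.mem_Icc]
    constructor
    · rintro (⟨_, h⟩ | ⟨h', h''⟩)
      · exact h
      · refine ⟨Nat.pos_of_ne_zero ?_, h''⟩
        rintro rfl
        exact h' h.zero_mem
    · tauto
  have u2 : {n | n ∉ A ∧ n ≤ g} ∪ {n | n ∉ A ∧ g < n} = {n | n ∉ A} := by
    ext n
    simp only [Set.mem_union, Set.mem_ofPred_eq]
    have := le_or_gt n g
    tauto
  rw [u1, Set.ncard_coe_finset, Nat.card_Icc, h.ncard_small] at e1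
  rw [u2, h.ncard_gaps] at e2
  omega

theorem eq_ordinary (h : HasSmallElements g 0 A) : A = ordinary g := by
  have h1 := h.ncard_small
  rw [Set.ncard_eq_zero (finite_small g A), Set.eq_empty_iff_forall_notMem] at h1
  have h2 := h.ncard_large
  rw [Set.ncard_eq_zero (h.finite.subset fun _ h => h.1), Set.eq_empty_iff_forall_notMem] at h2
  ext n
  have h1 := h1 n
  have h2 := h2 n
  simp only [Set.mem_ofPred_eq] at h1 h2
  simp only [ordinary, Set.mem_ofPred_eq]
  constructor
  · intro hn
    by_contra!
    exact h1 ⟨hn, by omega, by omega⟩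
  · rintro (rfl | hn)
    · exact h.zero_mem
    · by_contra hA
      exact h2 ⟨hA, by omega⟩

theorem ne_ordinary (h : HasSmallElements g (k + 1) A) : A ≠ ordinary g := by
  rintro rfl
  have h1 := h.ncard_small
  obtain ⟨n, hn, h1, h2⟩ := Set.nonempty_of_ncard_ne_zero (by rw [h1]; omega)
  rcases hn with hn | hn <;> omega

/-- A small element and a large gap exist, so `m ≤ g < F`: the transform loses one small element,
and the added `F` is not small. -/
theorem transform (h : HasSmallElements g (k + 1) A) :
    HasSmallElements g k (ordinarizationTransform A) := by
  obtain ⟨l, hlA, hlg⟩ := Set.nonempty_of_ncard_ne_zero (s := {n | n ∉ A ∧ g < n})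
    (by rw [h.ncard_large]; omega)
  obtain ⟨s, hsA, hs1, hsg⟩ := Set.nonempty_of_ncard_ne_zero
    (s := {n | n ∈ A ∧ 1 ≤ n ∧ n ≤ g}) (by rw [h.ncard_small]; omega)
  have hF : frobeniusOf A ∉ A := Nat.sSup_mem (s := {n | n ∉ A}) ⟨l, hlA⟩ h.finite.bddAbove
  have hgF : g < frobeniusOf A :=
    hlg.trans_le (le_csSup (s := {n | n ∉ A}) h.finite.bddAbove hlA)
  obtain ⟨hmA, hm⟩ : multiplicityOf A ∈ {n | n ∈ A ∧ 0 < n} := Nat.sInf_mem ⟨s, hsA, hs1⟩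
  have hmg : multiplicityOf A ≤ g :=
    (Nat.sInf_le (s := {n | n ∈ A ∧ 0 < n}) ⟨hsA, hs1⟩).trans hsg
  have hgaps : {n | n ∉ ordinarizationTransform A} =
      insert (multiplicityOf A) ({n | n ∉ A} \ {frobeniusOf A}) := by
    ext n
    simp only [ordinarizationTransform, Set.mem_ofPred_eq, Set.mem_sdiff, Set.mem_union,
      Set.mem_singleton_iff, Set.mem_insert_iff]
    tauto
  have hsmall : {n | n ∈ ordinarizationTransform A ∧ 1 ≤ n ∧ n ≤ g} =
      {n | n ∈ A ∧ 1 ≤ n ∧ n ≤ g} \ {multiplicityOf A} := by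
    ext n
    simp only [ordinarizationTransform, Set.mem_ofPred_eq, Set.mem_sdiff, Set.mem_union,
      Set.mem_singleton_iff]
    constructor
    · rintro ⟨⟨hn | hn, hn'⟩, h1, h2⟩
      · exact ⟨⟨hn, h1, h2⟩, hn'⟩
      · omega
    · rintro ⟨⟨hn, h1, h2⟩, hn'⟩
      exact ⟨⟨Or.inl hn, hn'⟩, h1, h2⟩
  refine ⟨⟨Or.inl h.zero_mem, fun e => ?_⟩, ?_, ?_, ?_⟩
  · rw [Set.mem_singleton_iff] at e
    omega
  · rw [hgaps]
    exact (h.finite.sdiff).insert _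
  · rw [hgaps, Set.ncard_insert_of_notMem (fun hh => hh.1 hmA) h.finite.sdiff,
      Set.ncard_sdiff_singleton_add_one hF h.finite, h.ncard_gaps]
  · have hmem : multiplicityOf A ∈ {n | n ∈ A ∧ 1 ≤ n ∧ n ≤ g} := ⟨hmA, hm, hmg⟩
    rw [hsmall, Set.ncard_sdiff_singleton_of_mem hmem, h.ncard_small]
    rfl

theorem iterate (h : HasSmallElements g k A) {j : ℕ} (hj : j ≤ k) :
    HasSmallElements g (k - j) (ordinarizationTransform^[j] A) := by
  induction j with
  | zero => exact h
  | succ j ih =>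
    rw [Function.iterate_succ_apply']
    have := ih (by omega)
    rw [show k - j = k - (j + 1) + 1 by omega] at this
    exact this.transform

end HasSmallElements

theorem ordinarizationNumber_eq (S : NumericalSemigroup) :
    S.ordinarizationNumber = {n | n ∈ S.carrier ∧ 1 ≤ n ∧ n ≤ S.genus}.ncard := by
  set k := {n | n ∈ S.carrier ∧ 1 ≤ n ∧ n ≤ S.genus}.ncard with hk
  have h : HasSmallElements S.genus k S.carrier := ⟨S.zero_mem', S.finite_gaps, rfl, rfl⟩
  have hmem : k ∈ {j | ordinarizationTransform^[j] S.carrier = ordinary S.genus} := by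
    have := h.iterate le_rfl
    rw [Nat.sub_self] at this
    exact this.eq_ordinary
  refine le_antisymm (Nat.sInf_le hmem) (le_csInf ⟨k, hmem⟩ fun j hj => ?_)
  by_contra! hlt
  have := h.iterate hlt.le
  rw [show k - j = k - j - 1 + 1 by omega] at this
  exact this.ne_ordinary hj

/-- If `n` is a gap, `x ↦ n - x` injects the elements of `S` in `[0, n]` into the gaps, so `n + 1 ≤
2 * genus`. -/
theorem lt_two_mul_genus (S : NumericalSemigroup) {n : ℕ} (hn : n ∉ S.carrier) :
    n < 2 * S.genus := by
  classical
  have hG : S.genus = S.finite_gaps.toFinset.card := Set.ncard_eq_toFinset_card _ _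
  have h1 : ((Finset.range (n + 1)).filter fun x => x ∉ S.carrier).card ≤ S.genus := by
    rw [hG]
    refine Finset.card_le_card fun x hx => ?_
    simpa using (Finset.mem_filter.1 hx).2
  have h2 : ((Finset.range (n + 1)).filter fun x => x ∈ S.carrier).card ≤ S.genus := by
    rw [hG]
    refine Finset.card_le_card_of_injOn (fun x => n - x) (fun x hx => ?_) fun x hx y hy hxy => ?_
    · obtain ⟨hx1, hx2⟩ := Finset.mem_filter.1 hx
      rw [Finset.mem_range] at hx1
      rw [Finset.mem_coe, Set.Finite.mem_toFinset]
      intro hx3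
      refine hn ?_
      have := S.add_mem' hx2 hx3
      rwa [show x + (n - x) = n by omega] at this
    · have h1 := Finset.mem_range.1 (Finset.mem_filter.1 hx).1
      have h2 := Finset.mem_range.1 (Finset.mem_filter.1 hy).1
      simp only at hxy
      omega
  have h3 := Finset.card_filter_add_card_filter_not (s := Finset.range (n + 1))
    (fun x => x ∈ S.carrier)
  rw [Finset.card_range] at h3
  omega

theorem ext_carrier {S S' : NumericalSemigroup} (h : S.carrier = S'.carrier) : S = S' := by
  obtain ⟨S, _⟩ := S
  obtain ⟨S', _⟩ := S'
  congr
  exact SetLike.coe_injective h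

/-! ### Semigroups as integer points -/

/-- The conditions under which `a 0 < a 1 < ⋯` and `b 0 < b 1 < ⋯` are the positive elements up to
`g` and the gaps beyond `g` of a numerical semigroup of genus `g`, for `x = (g, a, b)`. -/
def IsGapDatum {r : ℕ} (x : ℕ × (Fin r → ℕ) × (Fin r → ℕ)) : Prop :=
  (∀ i j, i < j → x.2.1 i < x.2.1 j) ∧ (∀ i j, i < j → x.2.2 i < x.2.2 j) ∧
  (∀ i, 1 ≤ x.2.1 i ∧ x.2.1 i ≤ x.1) ∧ (∀ i, x.1 < x.2.2 i ∧ x.2.2 i < 2 * x.1) ∧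
  (∀ i j, x.2.1 i + x.2.1 j ≤ x.1 → ∃ k, x.2.1 i + x.2.1 j = x.2.1 k) ∧
  (∀ i j k, ¬ x.2.1 i + x.2.1 j = x.2.2 k) ∧
  (∀ i k, x.1 + x.2.1 i < x.2.2 k → ∃ l, x.2.2 k = x.2.1 i + x.2.2 l)

namespace IsGapDatum

theorem splitsSemilinear (r : ℕ) :
    SplitsSemilinear (IsGapDatum : ℕ × (Fin r → ℕ) × (Fin r → ℕ) → Prop) := by
  have hg : IsIntAffine fun x : ℕ × (Fin r → ℕ) × (Fin r → ℕ) => (x.1 : ℤ) :=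
    .natCast_hom (AddMonoidHom.fst ℕ ((Fin r → ℕ) × (Fin r → ℕ)))
  have ha : ∀ i, IsIntAffine fun x : ℕ × (Fin r → ℕ) × (Fin r → ℕ) => (x.2.1 i : ℤ) := fun i =>
    .natCast_hom ((Pi.evalAddMonoidHom (fun _ : Fin r => ℕ) i).comp
      ((AddMonoidHom.fst (Fin r → ℕ) (Fin r → ℕ)).comp (AddMonoidHom.snd ℕ _)))
  have hb : ∀ i, IsIntAffine fun x : ℕ × (Fin r → ℕ) × (Fin r → ℕ) => (x.2.2 i : ℤ) := fun i =>
    .natCast_hom ((Pi.evalAddMonoidHom (fun _ : Fin r => ℕ) i).comp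
      ((AddMonoidHom.snd (Fin r → ℕ) (Fin r → ℕ)).comp (AddMonoidHom.snd ℕ _)))
  refine .and (.forall_fintype fun i => .forall_fintype fun j => .imp (.const _) ?_)
    (.and (.forall_fintype fun i => .forall_fintype fun j => .imp (.const _) ?_)
    (.and (.forall_fintype fun i => .and ?_ ?_) (.and (.forall_fintype fun i => .and ?_ ?_)
    (.and (.forall_fintype fun i => .forall_fintype fun j => .imp ?_ (.exists_fintype fun k => ?_))
    (.and (.forall_fintype fun i => .forall_fintype fun j => .forall_fintype fun k => .not ?_)
    (.forall_fintype fun i => .forall_fintype fun k => .imp ?_ (.exists_fintype fun l => ?_)))))))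
  · exact (SplitsSemilinear.lt (ha i) (ha j)).congr fun _ => by omega
  · exact (SplitsSemilinear.lt (hb i) (hb j)).congr fun _ => by omega
  · exact (SplitsSemilinear.le (.const 1) (ha i)).congr fun _ => by omega
  · exact (SplitsSemilinear.le (ha i) hg).congr fun _ => by omega
  · exact (SplitsSemilinear.lt hg (hb i)).congr fun _ => by omega
  · exact (SplitsSemilinear.lt (hb i) (hg.add hg)).congr fun _ => by omega
  · exact (SplitsSemilinear.le ((ha i).add (ha j)) hg).congr fun _ => by omega
  · exact (SplitsSemilinear.eq ((ha i).add (ha j)) (ha k)).congr fun _ => by omega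
  · exact (SplitsSemilinear.eq ((ha i).add (ha j)) (hb k)).congr fun _ => by omega
  · exact (SplitsSemilinear.lt (hg.add (ha i)) (hb k)).congr fun _ => by omega
  · exact (SplitsSemilinear.eq (hb k) ((ha i).add (hb l))).congr fun _ => by omega

variable {r : ℕ} {x : ℕ × (Fin r → ℕ) × (Fin r → ℕ)}

theorem strictMono_fst (h : IsGapDatum x) : StrictMono x.2.1 := fun i j => h.1 i j

theorem strictMono_snd (h : IsGapDatum x) : StrictMono x.2.2 := fun i j => h.2.1 i j

/-- The numerical semigroup with prescribed positive elements up to `g` and gaps beyond `g`. -/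
def toNumericalSemigroup (x : ℕ × (Fin r → ℕ) × (Fin r → ℕ)) (h : IsGapDatum x) :
    NumericalSemigroup where
  carrier := {n | n = 0 ∨ (∃ i, n = x.2.1 i) ∨ (x.1 < n ∧ ∀ i, n ≠ x.2.2 i)}
  zero_mem' := Or.inl rfl
  add_mem' := by
    obtain ⟨_, _, ha, hb, haa, hab, hba⟩ := h
    -- If a small element plus some `n > g` is a large gap, then the last condition of the datum
    -- makes `n` a large gap too.
    have key : ∀ i n, x.1 < n → (∀ k, n ≠ x.2.2 k) → ∀ k, x.2.1 i + n ≠ x.2.2 k := by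
      intro i n hn hn' k hk
      obtain ⟨l, hl⟩ := hba i k (by omega)
      exact hn' l (by omega)
    rintro m n (rfl | ⟨i, rfl⟩ | ⟨hm, hm'⟩) hn
    · simpa using hn
    · rcases hn with (rfl | ⟨j, rfl⟩ | ⟨hn, hn'⟩)
      · exact Or.inr (Or.inl ⟨i, rfl⟩)
      · by_cases hle : x.2.1 i + x.2.1 j ≤ x.1
        · exact Or.inr (Or.inl (haa i j hle))
        · exact Or.inr (Or.inr ⟨by omega, hab i j⟩)
      · exact Or.inr (Or.inr ⟨by omega, key i n hn hn'⟩)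
    · rcases hn with (rfl | ⟨j, rfl⟩ | ⟨hn, hn'⟩)
      · exact Or.inr (Or.inr ⟨hm, hm'⟩)
      · rw [add_comm]
        exact Or.inr (Or.inr ⟨by omega, key j m hm hm'⟩)
      -- Two elements beyond `g` add up to more than `2g`, past every gap; this is why the datum
      -- needs no condition for such sums.
      · refine Or.inr (Or.inr ⟨by omega, fun k hk => ?_⟩)
        have := (hb k).2
        omega
  finite_gaps := by
    refine (Set.finite_Iio (2 * x.1 + 1)).subset fun n hn => ?_
    rw [Set.mem_Iio]
    by_contra! hlt
    refine hn (Or.inr (Or.inr ⟨by omega, fun i hi => ?_⟩))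
    have := (h.2.2.2.1 i).2
    omega

theorem mem_carrier (h : IsGapDatum x) {n : ℕ} : n ∈ (toNumericalSemigroup x h).carrier ↔
    n = 0 ∨ (∃ i, n = x.2.1 i) ∨ (x.1 < n ∧ ∀ i, n ≠ x.2.2 i) := Iff.rfl

theorem setOf_small (h : IsGapDatum x) :
    {n | n ∈ (toNumericalSemigroup x h).carrier ∧ 1 ≤ n ∧ n ≤ x.1} = Set.range x.2.1 := by
  ext n
  simp only [Set.mem_ofPred_eq, mem_carrier, Set.mem_range]
  constructor
  · rintro ⟨rfl | ⟨i, rfl⟩ | ⟨hn, _⟩, h1, h2⟩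
    · omega
    · exact ⟨i, rfl⟩
    · omega
  · rintro ⟨i, rfl⟩
    exact ⟨Or.inr (Or.inl ⟨i, rfl⟩), h.2.2.1 i⟩

theorem setOf_large (h : IsGapDatum x) :
    {n | n ∉ (toNumericalSemigroup x h).carrier ∧ x.1 < n} = Set.range x.2.2 := by
  ext n
  simp only [Set.mem_ofPred_eq, mem_carrier, Set.mem_range]
  constructor
  · rintro ⟨h1, h2⟩
    by_contra! h3
    exact h1 (Or.inr (Or.inr ⟨h2, fun i => (h3 i).symm⟩))
  · rintro ⟨i, rfl⟩
    have hi := (h.2.2.2.1 i).1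
    refine ⟨?_, hi⟩
    rintro (h0 | ⟨j, hj⟩ | ⟨_, h1⟩)
    · omega
    · have := (h.2.2.1 j).2
      omega
    · exact h1 i rfl

theorem ncard_range {a : Fin r → ℕ} (ha : Function.Injective a) : (Set.range a).ncard = r := by
  rw [← Set.image_univ, Set.ncard_image_of_injective _ ha, Set.ncard_univ, Nat.card_fin]

theorem genus_eq (h : IsGapDatum x) : (toNumericalSemigroup x h).genus = x.1 := by
  have hsub : Set.range x.2.1 ⊆ Set.Icc 1 x.1 := by
    rintro _ ⟨i, rfl⟩
    exact h.2.2.1 i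
  have e : {n | n ∉ (toNumericalSemigroup x h).carrier} =
      (Set.Icc 1 x.1 \ Set.range x.2.1) ∪ Set.range x.2.2 := by
    rw [← h.setOf_large, ← h.setOf_small]
    ext n
    have h0 : n = 0 → n ∈ (toNumericalSemigroup x h).carrier := fun h => Or.inl h
    simp only [Set.mem_ofPred_eq, Set.mem_union, Set.mem_sdiff, Set.mem_Icc]
    rcases Nat.eq_zero_or_pos n with hn | hn
    · have := h0 hn
      subst hn
      simp [this]
    · have := le_or_gt n x.1
      have : 1 ≤ n := hn
      tauto
  have h1 := Set.ncard_sdiff hsub (Set.finite_range _)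
  have h2 := Set.ncard_le_ncard hsub (Set.finite_Icc _ _)
  have h3 : (Set.Icc 1 x.1).ncard = x.1 := by
    rw [← Finset.coe_Icc, Set.ncard_coe_finset, Nat.card_Icc, Nat.add_sub_cancel]
  rw [ncard_range h.strictMono_fst.injective, h3] at h1 h2
  rw [genus, e, Set.ncard_union_eq _ ((Set.finite_Icc _ _).sdiff) (Set.finite_range _), h1,
    ncard_range h.strictMono_snd.injective]
  · omega
  · rw [Set.disjoint_left]
    rintro n ⟨⟨_, hn⟩, _⟩ ⟨i, rfl⟩
    have := (h.2.2.2.1 i).1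
    omega

end IsGapDatum

theorem exists_strictMono_range_eq {s : Set ℕ} {r : ℕ} (hs : s.Finite) (hr : s.ncard = r) :
    ∃ a : Fin r → ℕ, StrictMono a ∧ Set.range a = s := by
  have hc : hs.toFinset.card = r := by rw [← Set.ncard_eq_toFinset_card s hs, hr]
  exact ⟨hs.toFinset.orderEmbOfFin hc, (hs.toFinset.orderEmbOfFin hc).strictMono, by simp⟩

theorem count_eq (g r : ℕ) : count g r =
    {x : ℕ × (Fin r → ℕ) × (Fin r → ℕ) | IsGapDatum x ∧ x.1 = g}.ncard := by
  symm
  refine Set.ncard_congr (fun x hx => IsGapDatum.toNumericalSemigroup x hx.1) ?_ ?_ ?_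
  · rintro x ⟨h, rfl⟩
    refine ⟨h.genus_eq, ?_⟩
    rw [ordinarizationNumber_eq, h.genus_eq, h.setOf_small,
      IsGapDatum.ncard_range h.strictMono_fst.injective]
  · rintro x y ⟨hx, rfl⟩ ⟨hy, hxy⟩ h
    have hc : (IsGapDatum.toNumericalSemigroup x hx).carrier =
        (IsGapDatum.toNumericalSemigroup y hy).carrier := congrArg (fun S => S.carrier) h
    have h1 := hx.setOf_small
    have h2 := hx.setOf_large
    rw [hc, ← hxy, hy.setOf_small] at h1
    rw [hc, ← hxy, hy.setOf_large] at h2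
    exact Prod.ext hxy.symm (Prod.ext ((hx.strictMono_fst.range_inj hy.strictMono_fst).1 h1.symm)
      ((hx.strictMono_snd.range_inj hy.strictMono_snd).1 h2.symm))
  · rintro S ⟨rfl, hr⟩
    rw [ordinarizationNumber_eq] at hr
    have hsm : HasSmallElements S.genus r S.carrier := ⟨S.zero_mem', S.finite_gaps, rfl, hr⟩
    obtain ⟨a, ha, haS⟩ :=
      exists_strictMono_range_eq (HasSmallElements.finite_small S.genus S.carrier) hr
    obtain ⟨b, hb, hbS⟩ := exists_strictMono_range_eq
      (S.finite_gaps.subset fun n (hn : n ∉ S.carrier ∧ S.genus < n) => hn.1) hsm.ncard_large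
    have ha' : ∀ i, a i ∈ S.carrier ∧ 1 ≤ a i ∧ a i ≤ S.genus := fun i =>
      haS.le (Set.mem_range_self i)
    have hb' : ∀ i, b i ∉ S.carrier ∧ S.genus < b i := fun i => hbS.le (Set.mem_range_self i)
    have haE : ∀ n, n ∈ S.carrier → 1 ≤ n → n ≤ S.genus → ∃ i, n = a i := fun n h1 h2 h3 => by
      obtain ⟨i, hi⟩ := haS.ge ⟨h1, h2, h3⟩
      exact ⟨i, hi.symm⟩
    have hbE : ∀ n, n ∉ S.carrier → S.genus < n → ∃ i, n = b i := fun n h1 h2 => by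
      obtain ⟨i, hi⟩ := hbS.ge ⟨h1, h2⟩
      exact ⟨i, hi.symm⟩
    have hdat : IsGapDatum (S.genus, a, b) := by
      refine ⟨fun i j h => ha h, fun i j h => hb h, fun i => (ha' i).2,
        fun i => ⟨(hb' i).2, S.lt_two_mul_genus (hb' i).1⟩, fun i j h => ?_, fun i j k h => ?_,
        fun i k h => ?_⟩
      · have := (ha' i).2.1
        exact haE _ (S.add_mem' (ha' i).1 (ha' j).1) (by simp only; omega) h
      · exact (hb' k).1 ((show _ = b k from h) ▸ S.add_mem' (ha' i).1 (ha' j).1)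
      · simp only at h ⊢
        obtain ⟨l, hl⟩ := hbE (b k - a i) (fun hmem => (hb' k).1 (by
          have := S.add_mem' (ha' i).1 hmem
          rwa [show a i + (b k - a i) = b k by omega] at this)) (by omega)
        exact ⟨l, by omega⟩
    refine ⟨(S.genus, a, b), ⟨hdat, rfl⟩, ext_carrier ?_⟩
    ext n
    rw [hdat.mem_carrier]
    constructor
    · rintro (rfl | ⟨i, rfl⟩ | ⟨h1, h2⟩)
      · exact S.zero_mem'
      · exact (ha' i).1
      · by_contra hn
        obtain ⟨i, hi⟩ := hbE n hn h1
        exact h2 i hi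
    · intro hn
      rcases Nat.eq_zero_or_pos n with h0 | h0
      · exact Or.inl h0
      · right
        rcases le_or_gt n S.genus with h1 | h1
        · exact Or.inl (haE n hn h0 h1)
        · exact Or.inr ⟨h1, fun i hi => (hb' i).1 ((show n = b i from hi) ▸ hn)⟩

/-! ### Growth bounds and conclusion -/

theorem setOf_isGapDatum_subset (g r : ℕ) :
    {x : ℕ × (Fin r → ℕ) × (Fin r → ℕ) | IsGapDatum x ∧ x.1 = g} ⊆
      (({g} ×ˢ (Fintype.piFinset fun _ => Finset.range (2 * g + 1)) ×ˢ
        (Fintype.piFinset fun _ => Finset.range (2 * g + 1)) :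
          Finset (ℕ × (Fin r → ℕ) × (Fin r → ℕ))) : Set (ℕ × (Fin r → ℕ) × (Fin r → ℕ))) := by
  rintro x ⟨h, rfl⟩
  simp only [Finset.coe_product, Set.mem_prod, Finset.mem_coe, Finset.mem_singleton,
    Fintype.mem_piFinset, Finset.mem_range, true_and]
  refine ⟨fun i => ?_, fun i => ?_⟩
  · have := (h.2.2.1 i).2
    omega
  · have := (h.2.2.2.1 i).2
    omega

theorem count_le (g r : ℕ) : count g r ≤ (2 * g + 1) ^ (2 * r) := by
  rw [count_eq]
  refine (Set.ncard_le_ncard (setOf_isGapDatum_subset g r) (Finset.finite_toSet _)).trans ?_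
  rw [Set.ncard_coe_finset]
  simp [Finset.card_product, ← pow_add, two_mul]

/-- With `g = 3rk`, place the small elements in `(2rk, 3rk]` and the large gaps in `(3rk, 4rk]`.
Sums of two small elements exceed `4rk`, and `g` plus a small element exceeds `5rk`, so all additive
conditions hold vacuously or trivially. -/
theorem pow_le_count (k r : ℕ) : k ^ (2 * r) ≤ count (3 * r * k) r := by
  rw [count_eq]
  -- Each interval is cut into `r` blocks of length `k` with one free choice per block, which makes
  -- the sequences increasing automatically.
  let f : (Fin r → Fin k) × (Fin r → Fin k) → ℕ × (Fin r → ℕ) × (Fin r → ℕ) := fun u =>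
    (3 * r * k, fun i => 2 * (r * k) + 1 + (i * k + u.1 i),
      fun i => 3 * (r * k) + 1 + (i * k + u.2 i))
  have hf : Function.Injective f := by
    rintro ⟨u, v⟩ ⟨u', v'⟩ h
    simp only [f, Prod.mk.injEq, true_and] at h
    ext i
    · have := congrFun h.1 i
      simp only at this ⊢
      omega
    · have := congrFun h.2 i
      simp only at this ⊢
      omega
  have hlt : ∀ (i : Fin r) (w : Fin k), i * k + (w : ℕ) < r * k := fun i w => by
    have := Nat.mul_le_mul_right k (Nat.succ_le_of_lt i.2)
    rw [Nat.succ_mul] at this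
    omega
  have hmono : ∀ (i j : Fin r) (w w' : Fin k), i < j → i * k + (w : ℕ) < j * k + (w' : ℕ) :=
    fun i j w w' hij => by
      have := Nat.mul_le_mul_right k (Nat.succ_le_of_lt hij)
      rw [Nat.succ_mul] at this
      omega
  have hsub : Set.range f ⊆ {x | IsGapDatum x ∧ x.1 = 3 * r * k} := by
    rintro _ ⟨⟨u, v⟩, rfl⟩
    have e : 3 * r * k = 3 * (r * k) := mul_assoc _ _ _
    refine ⟨⟨fun i j h => ?_, fun i j h => ?_, fun i => ?_, fun i => ?_, fun i j => ?_,
      fun i j k => ?_, fun i k => ?_⟩, rfl⟩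
    · have := hmono i j (u i) (u j) h
      simp only [f]; omega
    · have := hmono i j (v i) (v j) h
      simp only [f]; omega
    · have := hlt i (u i)
      simp only [f]; omega
    · have := hlt i (v i)
      simp only [f]; omega
    · simp only [f]; omega
    · have := hlt k (v k)
      simp only [f]; omega
    · have := hlt k (v k)
      simp only [f]; omega
  refine le_trans (le_of_eq ?_) (Set.ncard_le_ncard hsub
    ((Finset.finite_toSet _).subset (setOf_isGapDatum_subset _ r)))
  rw [← Set.image_univ, Set.ncard_image_of_injective _ hf, Set.ncard_univ]
  simp [← pow_add, two_mul]

/-- The regrouping of `1 + r + r` coordinates into a triple. -/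
def gapDatumHom (r : ℕ) : (Unit ⊕ Fin r ⊕ Fin r → ℕ) →+ ℕ × (Fin r → ℕ) × (Fin r → ℕ) where
  toFun y := (y (.inl ()), fun i => y (.inr (.inl i)), fun i => y (.inr (.inr i)))
  map_zero' := rfl
  map_add' _ _ := rfl

theorem gapDatumHom_apply (r : ℕ) (y : Unit ⊕ Fin r ⊕ Fin r → ℕ) : gapDatumHom r y =
    (y (.inl ()), fun i => y (.inr (.inl i)), fun i => y (.inr (.inr i))) := rfl

theorem gapDatumHom_bijective (r : ℕ) : Function.Bijective (gapDatumHom r) := by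
  constructor
  · intro y z h
    rw [gapDatumHom_apply, gapDatumHom_apply, Prod.mk.injEq, Prod.mk.injEq] at h
    ext (i | i | i)
    · exact h.1
    · exact congrFun h.2.1 i
    · exact congrFun h.2.2 i
  · intro x
    exact ⟨Sum.elim (fun _ => x.1) (Sum.elim x.2.1 x.2.2), rfl⟩

theorem eventuallyQuasipolynomial_count (r : ℕ) :
    EventuallyQuasipolynomial fun g => (count g r : ℚ) := by
  -- The whole space of triples is itself a free monoid, the starting set to be cut down by
  -- `IsGapDatum`.
  have huniv := UnambiguousSemilinear.range_of_injective _ (gapDatumHom_bijective r).1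
  rw [(gapDatumHom_bijective r).2.range_eq] at huniv
  have hT := (IsGapDatum.splitsSemilinear r _ huniv).1
  rw [Set.univ_inter] at hT
  simp only [count_eq]
  exact hT.eventuallyQuasipolynomial_ncard (AddMonoidHom.fst ℕ ((Fin r → ℕ) × (Fin r → ℕ))) fun n =>
    (Finset.finite_toSet _).subset (setOf_isGapDatum_subset n r)

end NumericalSemigroup

theorem theorem3p1 (r : ℕ) (hr : 1 ≤ r) :
    IsEventuallyQuasipolynomialOfDegree
      (fun g : ℕ => NumericalSemigroup.count g r) (2 * r) :=
  (NumericalSemigroup.eventuallyQuasipolynomial_count r).isEventuallyQuasipolynomialOfDegree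
    (K := 3 * r) (by omega) (fun n => NumericalSemigroup.count_le n r)
    (fun k => NumericalSemigroup.pow_le_count k r)
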